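/- Let $a>0$, let $q_1:[-a,a]\to\mathbb{C}$ be continuous, and let $f\in C^2(-a,a)\cap C^1[-a,a]$ be a complex-valued solution of $f''-q_1f=0$ on $(-a,a)$ with $f(x)\neq 0$ for all $x\in[-a,a]$ and $f(0)=1$. Put $h:=f'(0)\in\mathbb{C}$ and let $q_2:=2(f'/f)^2-q_1$ be the Darboux-transformed potential on $[-a,a]$. For $j=1,2$ consider the Goursat problem $$\frac{\partial^2H_j(u,v)}{\partial u\,\partial v}=q_j(u+v)H_j(u,v),\qquad H_j(u,0)=\frac12\int_0^uq_j(s)\,ds,\qquad H_j(0,v)=0,$$ for $H_j$ continuous on $\{(u,v)\in\mathbb{R}^2: uv\ge 0,\ |u+v|\le a\}$, where the differential equation is required in the interior of this set. For $\kappa\in\mathbb{C}$ and $u\in C[-a,a]$ let $$\mathbf{T}_{j;\kappa}u(x)=u(x)+\int_{-x}^{x}\mathbf{K}_j(x,t;\kappa)u(t)\,dt,\qquad x\in[-a,a],$$ where $$\mathbf{K}_j(x,t;\kappa)=\frac{\kappa}{2}+K_j(x,t)+\frac{\kappa}{2}\int_t^x\big(K_j(x,s)-K_j(x,-s)\big)\,ds,\qquad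 K_j(x,t)=H_j\Big(\frac{x+t}{2},\frac{x-t}{2}\Big),$$ be the transmutation operator for the operator $A_j=\frac{d^2}{dx^2}-q_j$ with parameter $\kappa$. Then both Goursat problems have exactly one solution (so that $\mathbf{T}_{1;h}$ and $\mathbf{T}_{2;-h}$ are well defined), and for every $\omega\in\mathbb{C}$ and every solution $u\in C^2(-a,a)\cap C^1[-a,a]$ of $u''+\omega^2u=0$ on $(-a,a)$, the operator $$T_2[u](x)=\frac{1}{f(x)}\bigg(\int_0^xf(\eta)\,\mathbf{T}_{1;h}[u'](\eta)\,d\eta+u(0)\bigg)$$ satisfies $T_2[u](x)=\mathbf{T}_{2;-h}[u](x)$ for all $x\in[-a,a]$. -/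

import Mathlib

open Set MeasureTheory

noncomputable section

namespace DarbouxTransmutation

/-- `u ∈ C²(-a,a) ∩ C¹[-a,a]` is a solution of `u'' - q u = lam u` on `(-a,a)`. -/
structure IsSLSolution (a : ℝ) (q : ℝ → ℂ) (lam : ℂ) (u : ℝ → ℂ) : Prop where
  contDiffOn_Icc : ContDiffOn ℝ 1 u (Icc (-a) a)
  contDiffOn_Ioo : ContDiffOn ℝ 2 u (Ioo (-a) a)
  equation : ∀ x ∈ Ioo (-a) a, deriv (deriv u) x - q x * u x = lam * u x

/-- The points `(u,v) = ((x+t)/2, (x-t)/2)` with `|t| ≤ |x| ≤ a`. -/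
def goursatDomain (a : ℝ) : Set (ℝ × ℝ) :=
  {p | 0 ≤ p.1 * p.2 ∧ |p.1 + p.2| ≤ a}

/-- The interior of `goursatDomain a`. -/
def goursatInterior (a : ℝ) : Set (ℝ × ℝ) :=
  {p | 0 < p.1 * p.2 ∧ |p.1 + p.2| < a}

/-- `H` is a (classical) solution of the Goursat problem `∂²H/∂u∂v = q(u+v) H`,
`H(u,0) = (1/2) ∫₀ᵘ q(s) ds`, `H(0,v) = 0`. -/
structure IsGoursatSolution (a : ℝ) (q : ℝ → ℂ) (H : ℝ → ℝ → ℂ) : Prop where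
  continuousOn : ContinuousOn (fun p : ℝ × ℝ => H p.1 p.2) (goursatDomain a)
  differentiable_v : ∀ u v : ℝ, (u, v) ∈ goursatInterior a →
    DifferentiableAt ℝ (fun s => H u s) v
  equation : ∀ u v : ℝ, (u, v) ∈ goursatInterior a →
    HasDerivAt (fun r => deriv (fun s => H r s) v) (q (u + v) * H u v) u
  boundary_u : ∀ u ∈ Icc (-a) a, H u 0 = (1 / 2 : ℂ) * ∫ s in (0 : ℝ)..u, q s
  boundary_v : ∀ v ∈ Icc (-a) a, H 0 v = 0

/-- The Goursat problem has a solution, and it is unique on `goursatDomain a`. -/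
def GoursatUniquelySolvable (a : ℝ) (q : ℝ → ℂ) : Prop :=
  ∃ H : ℝ → ℝ → ℂ, IsGoursatSolution a q H ∧
    ∀ G : ℝ → ℝ → ℂ, IsGoursatSolution a q G →
      ∀ u v : ℝ, (u, v) ∈ goursatDomain a → G u v = H u v

/-- `K(x,t) = H((x+t)/2, (x-t)/2)`. -/
def kernel (H : ℝ → ℝ → ℂ) (x t : ℝ) : ℂ := H ((x + t) / 2) ((x - t) / 2)

/-- `K(x,t;h) = h/2 + K(x,t) + (h/2) ∫ₜˣ (K(x,s) - K(x,-s)) ds`. -/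
def paramKernel (H : ℝ → ℝ → ℂ) (h : ℂ) (x t : ℝ) : ℂ :=
  h / 2 + kernel H x t + h / 2 * ∫ s in t..x, (kernel H x s - kernel H x (-s))

/-- The Volterra integral operator `T_h u(x) = u(x) + ∫_{-x}^{x} K(x,t;h) u(t) dt`, whose kernel
comes from the solution `H` of the Goursat problem. -/
def transmutation (H : ℝ → ℝ → ℂ) (h : ℂ) (u : ℝ → ℂ) (x : ℝ) : ℂ :=
  u x + ∫ t in (-x)..x, paramKernel H h x t * u t

/-- The Darboux-transformed potential `2 (f'/f)² - q` on `[-a,a]` (one-sided derivatives at the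
end points). -/
def darbouxPotential (a : ℝ) (q f : ℝ → ℂ) (x : ℝ) : ℂ :=
  2 * (derivWithin f (Icc (-a) a) x / f x) ^ 2 - q x

/-- `T₂[u](x) = (1/f(x)) (∫₀ˣ f(η) T₁[u'](η) dη + u(0))` for an operator `T₁`. -/
def darbouxOperator (a : ℝ) (f : ℝ → ℂ) (T₁ : (ℝ → ℂ) → ℝ → ℂ) (u : ℝ → ℂ) (x : ℝ) : ℂ :=
  1 / f x * ((∫ η in (0 : ℝ)..x, f η * T₁ (derivWithin u (Icc (-a) a)) η) + u 0)

end DarbouxTransmutation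

end

namespace DarbouxTransmutation

open Filter Topology
open scoped BoundedContinuousFunction

/-! Both sides of the claimed identity solve the same linear differential equation with the same
data at `0`.

Write `mu = -ω ^ 2`, `h = f'(0)`. The transmutation property says that `T_κ` sends a solution `w` of
`w'' = mu w` to the solution `y` of `y'' = (q + mu) y` with `y(0) = w(0)`, `y'(0) = w'(0) + κ w(0)`
(`exists_hasDerivAt_transmutation`). Applied to `u'` with `q₁`, `h` and to `u` with `q₂`, `-h`, it
gives `y₁` and `y₂`. With `I = ∫₀ˣ f y₁ + u(0)` and `g = f'/f`, the pairs `(I/f, y₁)` and `(y₂, y₂'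
+ g y₂)` solve one first-order system `Y' = -g Y + P`, `P' = mu Y + g P`. The parameters `h` and
`-h` make the initial values agree, so uniqueness gives `I/f = y₂` (`darboux_eq_of_hasDerivAt`).

The transmutation property is obtained for `κ = 0` by differentiating the integral twice along the
lines `u + v = x`; general `κ` reduces to it, since `T_κ w = T_0 W` with `W(s) = w(s) + (κ/2)
∫_{-s}^{s} w`, again a solution (`transmutation_eq_charTransmutation`).

The Goursat problem is solved by a contraction for the equivalent integral equation
(`exists_goursat_integral_solution`). Uniqueness among classical solutions comes from an
exponentially weighted maximum (`goursat_eq_zero_of_nonneg`). -/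

/-! ### Existence for the Goursat integral equation on the plane. -/

/-- Each integration from `0` gains a factor `1 / lam`. The weight `cosh` is even, so one estimate
serves both signs of `x`. -/
theorem norm_integral_le_cosh {lam C x : ℝ} (hlam : 0 < lam) (hC : 0 ≤ C) {F : ℝ → ℂ}
    (hF : ∀ s, ‖F s‖ ≤ C * Real.cosh (lam * s)) :
    ‖∫ s in (0 : ℝ)..x, F s‖ ≤ C / lam * Real.cosh (lam * x) := by
  have h1 : ‖∫ s in (0 : ℝ)..x, F s‖ ≤ |∫ s in (0 : ℝ)..x, C * Real.cosh (lam * s)| :=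
    intervalIntegral.norm_integral_le_abs_of_norm_le (Filter.Eventually.of_forall hF)
      (Continuous.intervalIntegrable (by fun_prop) _ _)
  have h2 : ∫ s in (0 : ℝ)..x, C * Real.cosh (lam * s) = C / lam * Real.sinh (lam * x) := by
    have := intervalIntegral.integral_eq_sub_of_hasDerivAt (a := 0) (b := x)
      (f := fun s => C / lam * Real.sinh (lam * s)) (f' := fun s => C * Real.cosh (lam * s))
      (fun s _ => by
        have := (((hasDerivAt_id s).const_mul lam).sinh).const_mul (C / lam)
        refine this.congr_deriv ?_
        simp only [id]
        field_simp)
      (Continuous.intervalIntegrable (by fun_prop) _ _)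
    simpa using this
  rw [h2, abs_mul, abs_of_nonneg (by positivity)] at h1
  refine h1.trans (mul_le_mul_of_nonneg_left ?_ (by positivity))
  rw [abs_le]
  constructor
  · have := Real.sinh_lt_cosh (-(lam * x))
    rw [Real.sinh_neg, Real.cosh_neg] at this
    linarith
  · exact (Real.sinh_lt_cosh _).le

theorem exists_goursat_integral_solution {q : ℝ → ℂ} (hq : Continuous q) {Q : ℝ}
    (hQ : ∀ x, ‖q x‖ ≤ Q) :
    ∃ H : ℝ → ℝ → ℂ, Continuous (fun p : ℝ × ℝ => H p.1 p.2) ∧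
      ∀ u v, H u v = (1 / 2 : ℂ) * (∫ s in (0 : ℝ)..u, q s) +
        ∫ s in (0 : ℝ)..v, ∫ r in (0 : ℝ)..u, q (r + s) * H r s := by
  have hQ0 : 0 ≤ Q := (norm_nonneg _).trans (hQ 0)
  set lam : ℝ := Q + 1 with hlam_def
  have hlam : 0 < lam := by positivity
  -- The double integral costs `Q / lam²`, and `2 Q ≤ (Q + 1)²`; this becomes the contraction
  -- constant.
  have hlam2 : Q / lam / lam ≤ 1 / 2 := by
    rw [div_div, div_le_div_iff₀ (by positivity) (by norm_num)]
    nlinarith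
  set w : ℝ → ℝ := fun x => Real.cosh (lam * x) with hw
  have hwc : Continuous w := by fun_prop
  have hwpos : ∀ x, 0 < w x := fun x => Real.cosh_pos _
  have hwC : Continuous fun x => (w x : ℂ) := Complex.continuous_ofReal.comp hwc
  have bound : ∀ (B : ℝ × ℝ → ℂ) (M : ℝ), 0 ≤ M → (∀ p, ‖B p‖ ≤ M) → ∀ u v : ℝ,
      ‖∫ s in (0 : ℝ)..v, ∫ r in (0 : ℝ)..u, q (r + s) * ((w r * w s : ℂ) * B (r, s))‖ ≤
        M / 2 * (w u * w v) := by
    intro B M hM hB u v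
    have h := norm_integral_le_cosh (x := v) (C := Q * M / lam * w u) hlam
      (by have := hwpos u; positivity)
      (F := fun s => ∫ r in (0 : ℝ)..u, q (r + s) * ((w r * w s : ℂ) * B (r, s)))
      (by
        intro s
        have h := norm_integral_le_cosh (x := u) (C := Q * M * w s) hlam
          (by have := hwpos s; positivity)
          (F := fun r => q (r + s) * ((w r * w s : ℂ) * B (r, s)))
          (by
            intro r
            rw [norm_mul, norm_mul, norm_mul, Complex.norm_real, Complex.norm_real,
              Real.norm_of_nonneg (hwpos r).le, Real.norm_of_nonneg (hwpos s).le]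
            calc ‖q (r + s)‖ * (w r * w s * ‖B (r, s)‖) ≤ Q * (w r * w s * M) := by
                  have h1 := hQ (r + s)
                  have h2 := hB (r, s)
                  have := hwpos r
                  have := hwpos s
                  gcongr
              _ = _ := by simp only [hw]; ring)
        refine h.trans (le_of_eq ?_)
        simp only [hw]; ring)
    refine h.trans ?_
    have : Q * M / lam * w u / lam * Real.cosh (lam * v) = (Q / lam / lam) * (M * (w u * w v)) := by
      simp only [hw]; ring
    rw [this]
    have h3 : 0 ≤ M * (w u * w v) := by
      have := hwpos u; have := hwpos v; positivity
    nlinarith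
  have hcont : ∀ B : ℝ × ℝ →ᵇ ℂ, Continuous fun p : ℝ × ℝ =>
      ∫ s in (0 : ℝ)..p.2, ∫ r in (0 : ℝ)..p.1, q (r + s) * ((w r * w s : ℂ) * B (r, s)) := by
    intro B
    refine intervalIntegral.continuous_parametric_intervalIntegral_of_continuous
      (f := fun (p : ℝ × ℝ) s => ∫ r in (0 : ℝ)..p.1, q (r + s) * ((w r * w s : ℂ) * B (r, s)))
      ?_ continuous_snd
    refine intervalIntegral.continuous_parametric_intervalIntegral_of_continuous
      (f := fun (p : (ℝ × ℝ) × ℝ) r => q (r + p.2) * ((w r * w p.2 : ℂ) * B (r, p.2)))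
      ?_ (by fun_prop)
    have := B.continuous
    fun_prop
  have hbd0 : ∀ u : ℝ, ‖(1 / 2 : ℂ) * ∫ s in (0 : ℝ)..u, q s‖ ≤ Q / lam * w u := by
    intro u
    rw [norm_mul]
    have := norm_integral_le_cosh (x := u) (C := Q) (F := q) hlam hQ0 (fun s =>
      (hQ s).trans (le_mul_of_one_le_right hQ0 (Real.one_le_cosh _)))
    have h2 : ‖(1 / 2 : ℂ)‖ ≤ 1 := by norm_num
    calc _ ≤ 1 * (Q / lam * w u) := by gcongr
      _ = _ := one_mul _
  have hcont0 : Continuous fun u : ℝ => (1 / 2 : ℂ) * ∫ s in (0 : ℝ)..u, q s :=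
    continuous_const.mul (intervalIntegral.continuous_primitive
      (fun _ _ => hq.intervalIntegrable _ _) _)
  -- The unknown is `B = H / (w u * w v)`, which is bounded on the whole plane although `H` need not
  -- be.
  let Φ : (ℝ × ℝ →ᵇ ℂ) → (ℝ × ℝ →ᵇ ℂ) := fun B =>
    BoundedContinuousFunction.ofNormedAddCommGroup
      (fun p => ((w p.1 * w p.2 : ℝ) : ℂ)⁻¹ * ((1 / 2 : ℂ) * (∫ s in (0 : ℝ)..p.1, q s) +
        ∫ s in (0 : ℝ)..p.2, ∫ r in (0 : ℝ)..p.1, q (r + s) * ((w r * w s : ℂ) * B (r, s))))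
      (by
        refine Continuous.mul ?_ ((hcont0.comp continuous_fst).add (hcont B))
        refine Continuous.inv₀ (by fun_prop) (fun p => ?_)
        have := hwpos p.1
        have := hwpos p.2
        exact_mod_cast (by positivity : w p.1 * w p.2 ≠ 0))
      (Q / lam + ‖B‖ / 2)
      (by
        rintro ⟨u, v⟩
        have h1 := hwpos u
        have h2 := hwpos v
        have h3 : 1 ≤ w v := Real.one_le_cosh _
        rw [norm_mul, norm_inv, Complex.norm_real, Real.norm_of_nonneg (by positivity),
          inv_mul_le_iff₀ (by positivity)]
        refine (norm_add_le _ _).trans ?_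
        have h4 := hbd0 u
        have h5 := bound B ‖B‖ (norm_nonneg _) B.norm_coe_le_norm u v
        have h6 : Q / lam * w u ≤ Q / lam * w u * w v :=
          le_mul_of_one_le_right (by positivity) h3
        dsimp only
        linarith)
  have hΦ : ∀ B p, Φ B p = ((w p.1 * w p.2 : ℝ) : ℂ)⁻¹ *
      ((1 / 2 : ℂ) * (∫ s in (0 : ℝ)..p.1, q s) +
        ∫ s in (0 : ℝ)..p.2, ∫ r in (0 : ℝ)..p.1, q (r + s) * ((w r * w s : ℂ) * B (r, s))) :=
    fun B p => rfl
  have hcontr : ContractingWith (1 / 2) Φ := by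
    refine ⟨by norm_num, LipschitzWith.of_dist_le_mul fun B B' => ?_⟩
    rw [BoundedContinuousFunction.dist_le (by positivity)]
    rintro ⟨u, v⟩
    have h1 := hwpos u
    have h2 := hwpos v
    have hsub : (∫ s in (0 : ℝ)..v, ∫ r in (0 : ℝ)..u, q (r + s) * ((w r * w s : ℂ) * B (r, s))) -
        (∫ s in (0 : ℝ)..v, ∫ r in (0 : ℝ)..u, q (r + s) * ((w r * w s : ℂ) * B' (r, s))) =
        ∫ s in (0 : ℝ)..v, ∫ r in (0 : ℝ)..u, q (r + s) * ((w r * w s : ℂ) * (B - B') (r, s)) := by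
      have hB := B.continuous
      have hB' := B'.continuous
      rw [← intervalIntegral.integral_sub]
      · congr 1; ext s
        rw [← intervalIntegral.integral_sub]
        · congr 1; ext r
          simp only [BoundedContinuousFunction.coe_sub, Pi.sub_apply]; ring
        · exact Continuous.intervalIntegrable (by fun_prop) _ _
        · exact Continuous.intervalIntegrable (by fun_prop) _ _
      · exact Continuous.intervalIntegrable (by fun_prop) _ _
      · exact Continuous.intervalIntegrable (by fun_prop) _ _
    rw [hΦ, hΦ, dist_eq_norm, ← mul_sub, add_sub_add_left_eq_sub, hsub, norm_mul, norm_inv,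
      Complex.norm_real, Real.norm_of_nonneg (by positivity), inv_mul_le_iff₀ (by positivity)]
    have h5 := bound (B - B') ‖B - B'‖ (norm_nonneg _) (B - B').norm_coe_le_norm u v
    refine h5.trans (le_of_eq ?_)
    rw [dist_eq_norm]
    simp; ring
  set B := ContractingWith.fixedPoint Φ hcontr with hBdef
  have hfix : Φ B = B := hcontr.fixedPoint_isFixedPt
  refine ⟨fun u v => (w u * w v : ℂ) * B (u, v), ?_, fun u v => ?_⟩
  · have := B.continuous
    fun_prop
  · have h1 := hwpos u
    have h2 := hwpos v
    have h := hΦ B (u, v)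
    rw [hfix] at h
    have hne : (w u * w v : ℂ) ≠ 0 := by exact_mod_cast (by positivity : w u * w v ≠ 0)
    change (w u * w v : ℂ) * B (u, v) = _
    rw [h]
    push_cast
    rw [mul_inv_cancel_left₀ hne]

/-! ### From the integral equation to the classical Goursat problem. -/

/-- `H` solves on all of `ℝ²` the integral equation equivalent to the Goursat problem. -/
structure IsGoursatIntegralSolution (q : ℝ → ℂ) (H : ℝ → ℝ → ℂ) : Prop where
  continuous : Continuous fun p : ℝ × ℝ => H p.1 p.2
  eq : ∀ u v, H u v = (1 / 2 : ℂ) * (∫ s in (0 : ℝ)..u, q s) +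
    ∫ s in (0 : ℝ)..v, ∫ r in (0 : ℝ)..u, q (r + s) * H r s

namespace IsGoursatIntegralSolution

variable {q : ℝ → ℂ} {H : ℝ → ℝ → ℂ}

theorem zero_left (hH : IsGoursatIntegralSolution q H) (v : ℝ) : H 0 v = 0 := by
  simp [hH.eq 0 v]

theorem zero_right (hH : IsGoursatIntegralSolution q H) (u : ℝ) :
    H u 0 = (1 / 2 : ℂ) * ∫ s in (0 : ℝ)..u, q s := by
  simp [hH.eq u 0]

theorem continuous_source (hH : IsGoursatIntegralSolution q H) (hq : Continuous q) :
    Continuous fun p : ℝ × ℝ => q (p.1 + p.2) * H p.1 p.2 :=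
  (hq.comp (continuous_fst.add continuous_snd)).mul hH.continuous

theorem continuous_integral_left (hH : IsGoursatIntegralSolution q H) (hq : Continuous q) :
    Continuous fun p : ℝ × ℝ => ∫ r in (0 : ℝ)..p.1, q (r + p.2) * H r p.2 :=
  intervalIntegral.continuous_parametric_intervalIntegral_of_continuous
    (f := fun (p : ℝ × ℝ) r => q (r + p.2) * H r p.2)
    ((hH.continuous_source hq).comp (continuous_snd.prodMk (continuous_snd.comp continuous_fst)))
    continuous_fst

theorem continuous_integral_right (hH : IsGoursatIntegralSolution q H) (hq : Continuous q) :
    Continuous fun p : ℝ × ℝ => ∫ s in (0 : ℝ)..p.2, q (p.1 + s) * H p.1 s :=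
  intervalIntegral.continuous_parametric_intervalIntegral_of_continuous
    (f := fun (p : ℝ × ℝ) s => q (p.1 + s) * H p.1 s)
    ((hH.continuous_source hq).comp ((continuous_fst.comp continuous_fst).prodMk continuous_snd))
    continuous_snd

theorem hasDerivAt_right (hH : IsGoursatIntegralSolution q H) (hq : Continuous q) (u v : ℝ) :
    HasDerivAt (fun s => H u s) (∫ r in (0 : ℝ)..u, q (r + v) * H r v) v := by
  have hc : Continuous fun s => ∫ r in (0 : ℝ)..u, q (r + s) * H r s :=
    (hH.continuous_integral_left hq).comp (by fun_prop : Continuous fun s : ℝ => (u, s))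
  have h := (hc.integral_hasStrictDerivAt 0 v).hasDerivAt.const_add
      ((1 / 2 : ℂ) * ∫ s in (0 : ℝ)..u, q s)
  exact h.congr_of_eventuallyEq (Eventually.of_forall fun s => hH.eq u s)

theorem eq_swap (hH : IsGoursatIntegralSolution q H) (hq : Continuous q) (u v : ℝ) :
    H u v = (1 / 2 : ℂ) * (∫ s in (0 : ℝ)..u, q s) +
      ∫ r in (0 : ℝ)..u, ∫ s in (0 : ℝ)..v, q (r + s) * H r s := by
  rw [hH.eq u v, intervalIntegral_intervalIntegral_swap]
  have hc : Continuous (Function.uncurry fun s r : ℝ => q (r + s) * H r s) :=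
    (hH.continuous_source hq).comp continuous_swap
  exact (hc.continuousOn.integrableOn_compact (isCompact_uIcc.prod isCompact_uIcc)).mono_set
    (prod_mono uIoc_subset_uIcc uIoc_subset_uIcc)

theorem hasDerivAt_left (hH : IsGoursatIntegralSolution q H) (hq : Continuous q) (u v : ℝ) :
    HasDerivAt (fun r => H r v)
      ((1 / 2 : ℂ) * q u + ∫ s in (0 : ℝ)..v, q (u + s) * H u s) u := by
  have hc : Continuous fun r => ∫ s in (0 : ℝ)..v, q (r + s) * H r s :=
    (hH.continuous_integral_right hq).comp (by fun_prop : Continuous fun r : ℝ => (r, v))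
  have h := ((hq.integral_hasStrictDerivAt 0 u).hasDerivAt.const_mul (1 / 2 : ℂ)).add
    (hc.integral_hasStrictDerivAt 0 u).hasDerivAt
  exact h.congr_of_eventuallyEq (Eventually.of_forall fun r => hH.eq_swap hq r v)

theorem isGoursatSolution (hH : IsGoursatIntegralSolution q H) (hq : Continuous q) {a : ℝ}
    (ha : 0 ≤ a) {q' : ℝ → ℂ} (hqq : EqOn q q' (Icc (-a) a)) : IsGoursatSolution a q' H where
  continuousOn := hH.continuous.continuousOn
  differentiable_v u v _ := (hH.hasDerivAt_right hq u v).differentiableAt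
  equation u v huv := by
    have hc : Continuous fun r => q (r + v) * H r v :=
      (hH.continuous_source hq).comp (by fun_prop : Continuous fun r : ℝ => (r, v))
    have h := (hc.integral_hasStrictDerivAt 0 u).hasDerivAt
    rw [← hqq (abs_le.1 huv.2.le)]
    exact h.congr_of_eventuallyEq
      (Eventually.of_forall fun r => (hH.hasDerivAt_right hq r v).deriv)
  boundary_u u hu := by
    rw [hH.zero_right]
    congr 1
    refine intervalIntegral.integral_congr fun s hs => hqq ?_
    exact (uIcc_subset_Icc ⟨by linarith, ha⟩ hu) hs
  boundary_v v _ := hH.zero_left v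

end IsGoursatIntegralSolution

/-! ### Uniqueness for the Goursat problem. -/

/-- Let `M` be the maximum of `‖D‖ exp(-lam (u + v))` on the triangle; the equation improves the
bound to `M / 2`, so `M = 0`. The equation is integrated by two mean value inequalities, which need
only the pointwise derivatives and no regularity of `∂D/∂v` in `v`. -/
theorem goursat_eq_zero_of_nonneg {a Q : ℝ} {q : ℝ → ℂ} {D : ℝ → ℝ → ℂ}
    (hQ : ∀ x ∈ Icc (-a) a, ‖q x‖ ≤ Q)
    (hc : ContinuousOn (fun p : ℝ × ℝ => D p.1 p.2) {p | 0 ≤ p.1 ∧ 0 ≤ p.2 ∧ p.1 + p.2 ≤ a})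
    (hv : ∀ u v, 0 < u → 0 < v → u + v < a → DifferentiableAt ℝ (fun s => D u s) v)
    (huv : ∀ u v, 0 < u → 0 < v → u + v < a →
      HasDerivAt (fun r => deriv (fun s => D r s) v) (q (u + v) * D u v) u)
    (h0 : ∀ u, 0 ≤ u → u ≤ a → D u 0 = 0) (h0' : ∀ v, 0 ≤ v → v ≤ a → D 0 v = 0)
    {u v : ℝ} (hu0 : 0 ≤ u) (hv0 : 0 ≤ v) (huva : u + v ≤ a) : D u v = 0 := by
  have ha : 0 ≤ a := by linarith
  have hQ0 : 0 ≤ Q := (norm_nonneg _).trans (hQ 0 ⟨by linarith, ha⟩)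
  set T : Set (ℝ × ℝ) := {p | 0 ≤ p.1 ∧ 0 ≤ p.2 ∧ p.1 + p.2 ≤ a} with hT
  set lam : ℝ := Q + 1
  have hlam : 0 < lam := by positivity
  have hlam2 : Q / lam / lam ≤ 1 / 2 := by
    rw [div_div, div_le_div_iff₀ (by positivity) (by norm_num)]
    nlinarith
  have hTc : IsCompact T := by
    refine (isCompact_Icc (a := ((0, 0) : ℝ × ℝ)) (b := (a, a))).of_isClosed_subset ?_ ?_
    · exact (isClosed_le continuous_const continuous_fst).inter
        ((isClosed_le continuous_const continuous_snd).inter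
          (isClosed_le (continuous_fst.add continuous_snd) continuous_const))
    · rintro ⟨x, y⟩ ⟨h1, h2, h3⟩
      dsimp only at h1 h2 h3
      exact ⟨⟨h1, h2⟩, ⟨by dsimp only; linarith, by dsimp only; linarith⟩⟩
  obtain ⟨p₀, hp₀, hmax⟩ := hTc.exists_isMaxOn ⟨(0, 0), by simp [hT, ha]⟩
    (hc.norm.mul (Continuous.continuousOn
      (by fun_prop : Continuous fun p : ℝ × ℝ => Real.exp (-(lam * (p.1 + p.2))))))
  set M : ℝ := ‖D p₀.1 p₀.2‖ * Real.exp (-(lam * (p₀.1 + p₀.2))) with hM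
  have hM0 : 0 ≤ M := by positivity
  have hDM : ∀ x y, 0 ≤ x → 0 ≤ y → x + y ≤ a → ‖D x y‖ ≤ M * Real.exp (lam * (x + y)) := by
    intro x y hx hy hxy
    have h : ‖D x y‖ * Real.exp (-(lam * (x + y))) ≤ M := hmax (show (x, y) ∈ T from ⟨hx, hy, hxy⟩)
    rwa [Real.exp_neg, ← div_eq_mul_inv, div_le_iff₀ (Real.exp_pos _)] at h
  have step1 : ∀ x y r, 0 < r → r ≤ x → 0 < y → x + y < a →
      ‖deriv (fun s => D x s) y - deriv (fun s => D r s) y‖ ≤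
        Q * M / lam * Real.exp (lam * (x + y)) := by
    intro x y r hr hrx hy hxy
    refine image_norm_le_of_norm_deriv_right_le_deriv_boundary (a := r) (b := x)
      (f := fun t => deriv (fun s => D t s) y - deriv (fun s => D r s) y)
      (f' := fun t => q (t + y) * D t y)
      (B := fun t => Q * M / lam * Real.exp (lam * (t + y)))
      (B' := fun t => Q * M * Real.exp (lam * (t + y))) ?_ ?_ ?_ ?_ ?_ ⟨hrx, le_rfl⟩
    · intro t ht
      exact ((huv t y (hr.trans_le ht.1) hy (by linarith [ht.2])).sub_const
        _).continuousAt.continuousWithinAt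
    · intro t ht
      exact ((huv t y (hr.trans_le ht.1) hy (by linarith [ht.2])).sub_const _).hasDerivWithinAt
    · simp only [sub_self, norm_zero]; positivity
    · intro t
      have := ((((hasDerivAt_id t).add_const y).const_mul lam).exp).const_mul (Q * M / lam)
      refine this.congr_deriv ?_
      simp only [id]
      field_simp
    · intro t ht
      rw [norm_mul]
      have h1 := hQ (t + y) ⟨by linarith [ht.1], by linarith [ht.2]⟩
      have h2 := hDM t y (by linarith [ht.1]) hy.le (by linarith [ht.2])
      calc _ ≤ Q * (M * Real.exp (lam * (t + y))) := by gcongr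
        _ = _ := by ring
  -- The second difference over the rectangle `[r, x] × [s, y]` stays in the interior, where the
  -- equation is available.
  have step2 : ∀ x y r s, 0 < r → r ≤ x → 0 < s → s ≤ y → x + y < a →
      ‖D x y - D r y - (D x s - D r s)‖ ≤ M / 2 * Real.exp (lam * (x + y)) := by
    intro x y r s hr hrx hs hsy hxy
    have hd : ∀ t ∈ Icc s y, HasDerivAt (fun t => D x t - D r t - (D x s - D r s))
        (deriv (fun s => D x s) t - deriv (fun s => D r s) t) t := fun t ht =>
      ((hv x t (by linarith) (by linarith [ht.1]) (by linarith [ht.2])).hasDerivAt.sub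
        (hv r t hr (by linarith [ht.1]) (by linarith [ht.2])).hasDerivAt).sub_const _
    have h := image_norm_le_of_norm_deriv_right_le_deriv_boundary (a := s) (b := y)
      (f := fun t => D x t - D r t - (D x s - D r s))
      (f' := fun t => deriv (fun s => D x s) t - deriv (fun s => D r s) t)
      (B := fun t => Q * M / lam / lam * Real.exp (lam * (x + t)))
      (B' := fun t => Q * M / lam * Real.exp (lam * (x + t)))
      (fun t ht => (hd t ht).continuousAt.continuousWithinAt)
      (fun t ht => (hd t ⟨ht.1, ht.2.le⟩).hasDerivWithinAt)
      (by simp only [sub_self, norm_zero]; positivity)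
      (by
        intro t
        have := ((((hasDerivAt_id t).const_add x).const_mul lam).exp).const_mul (Q * M / lam / lam)
        refine this.congr_deriv ?_
        simp only [id]
        field_simp)
      (fun t ht => step1 x t r hr hrx (by linarith [ht.1]) (by linarith [ht.2]))
      (right_mem_Icc.2 hsy)
    refine h.trans (mul_le_mul_of_nonneg_right ?_ (Real.exp_pos _).le)
    calc Q * M / lam / lam = M * (Q / lam / lam) := by ring
      _ ≤ M * (1 / 2) := by gcongr
      _ = M / 2 := by ring
  -- Letting the corner `(r, s) = (e, e)` tend to the origin turns the three other vertex values
  -- into boundary values, which vanish.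
  have step3 : ∀ x y, 0 < x → 0 < y → x + y < a →
      ‖D x y‖ ≤ M / 2 * Real.exp (lam * (x + y)) := by
    intro x y hx hy hxy
    have hlim : ∀ g : ℝ → ℝ × ℝ, Continuous g → g 0 ∈ T → (∀ᶠ e in 𝓝[>] (0 : ℝ), g e ∈ T) →
        Tendsto (fun e => D (g e).1 (g e).2) (𝓝[>] 0) (𝓝 (D (g 0).1 (g 0).2)) := by
      intro g hg h0T hgT
      refine (hc (g 0) h0T).tendsto.comp (tendsto_nhdsWithin_iff.2 ⟨?_, hgT⟩)
      exact (hg.tendsto 0).mono_left nhdsWithin_le_nhds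
    have hsmall : ∀ᶠ e in 𝓝[>] (0 : ℝ), 0 < e ∧ e < x ∧ e < y := by
      filter_upwards [self_mem_nhdsWithin,
        nhdsWithin_le_nhds (Iio_mem_nhds hx), nhdsWithin_le_nhds (Iio_mem_nhds hy)] with e h1 h2 h3
      exact ⟨h1, h2, h3⟩
    have h1 := hlim (fun e => (e, y)) (by fun_prop) ⟨le_rfl, hy.le, by dsimp only; linarith⟩
      (hsmall.mono fun e he => ⟨he.1.le, hy.le, by dsimp only; linarith⟩)
    have h2 := hlim (fun e => (x, e)) (by fun_prop) ⟨hx.le, le_rfl, by dsimp only; linarith⟩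
      (hsmall.mono fun e he => ⟨hx.le, he.1.le, by dsimp only; linarith⟩)
    have h3 := hlim (fun e => (e, e)) (by fun_prop) ⟨le_rfl, le_rfl, by dsimp only; linarith⟩
      (hsmall.mono fun e he => ⟨he.1.le, he.1.le, by dsimp only; linarith⟩)
    dsimp only at h1 h2 h3
    rw [h0' y hy.le (by linarith)] at h1
    rw [h0 x hx.le (by linarith)] at h2
    rw [h0 0 le_rfl ha] at h3
    have h4 := ((tendsto_const_nhds (x := D x y)).sub h1).sub (h2.sub h3)
    simp only [sub_zero] at h4
    exact le_of_tendsto h4.norm (hsmall.mono fun e he =>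
      step2 x y e e he.1 he.2.1.le he.1 he.2.2.le hxy)
  have step4 : ∀ x y, 0 ≤ x → 0 ≤ y → x + y ≤ a →
      ‖D x y‖ ≤ M / 2 * Real.exp (lam * (x + y)) := by
    intro x y hx hy hxy
    rcases hx.eq_or_lt with rfl | hx
    · rw [h0' y hy (by linarith), norm_zero]; positivity
    rcases hy.eq_or_lt with rfl | hy
    · rw [h0 x hx.le (by linarith), norm_zero]; positivity
    -- The side `u + v = a` is reached by scaling from inside.
    have hsmall : ∀ᶠ t in 𝓝[<] (1 : ℝ), 0 < t ∧ t < 1 := by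
      filter_upwards [self_mem_nhdsWithin,
        nhdsWithin_le_nhds (Ioi_mem_nhds (zero_lt_one' ℝ))] with e h1 h2
      exact ⟨h2, h1⟩
    have hlt : ∀ t : ℝ, 0 < t ∧ t < 1 → t * x + t * y < a := by
      intro t ht
      nlinarith [mul_pos (sub_pos.2 ht.2) (add_pos hx hy)]
    have hD : Tendsto (fun t : ℝ => D (t * x) (t * y)) (𝓝[<] 1) (𝓝 (D x y)) := by
      refine (hc (x, y) ⟨hx.le, hy.le, hxy⟩).tendsto.comp (tendsto_nhdsWithin_iff.2
        ⟨?_, hsmall.mono fun t ht => show (t * x, t * y) ∈ T from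
          ⟨(mul_pos ht.1 hx).le, (mul_pos ht.1 hy).le, (hlt t ht).le⟩⟩)
      have h := (by fun_prop : Continuous fun t : ℝ => (t * x, t * y)).tendsto 1
      rw [one_mul, one_mul] at h
      exact h.mono_left nhdsWithin_le_nhds
    have hE : Tendsto (fun t : ℝ => M / 2 * Real.exp (lam * (t * x + t * y))) (𝓝[<] 1)
        (𝓝 (M / 2 * Real.exp (lam * (x + y)))) := by
      have h := (by fun_prop : Continuous fun t : ℝ =>
        M / 2 * Real.exp (lam * (t * x + t * y))).tendsto 1
      rw [one_mul, one_mul] at h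
      exact h.mono_left nhdsWithin_le_nhds
    exact le_of_tendsto_of_tendsto hD.norm hE (hsmall.mono fun t ht =>
      step3 _ _ (mul_pos ht.1 hx) (mul_pos ht.1 hy) (hlt t ht))
  have hM2 : M ≤ M / 2 := by
    have h := step4 p₀.1 p₀.2 hp₀.1 hp₀.2.1 hp₀.2.2
    rwa [← div_le_iff₀ (Real.exp_pos _), div_eq_mul_inv, ← Real.exp_neg] at h
  have hMz : M = 0 := by linarith
  have h := hDM u v hu0 hv0 huva
  rw [hMz, zero_mul] at h
  exact norm_le_zero_iff.1 h

theorem IsGoursatSolution.unique {a : ℝ} {q : ℝ → ℂ} (hq : ContinuousOn q (Icc (-a) a))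
    {G H : ℝ → ℝ → ℂ} (hG : IsGoursatSolution a q G) (hH : IsGoursatSolution a q H) {u v : ℝ}
    (huv : (u, v) ∈ goursatDomain a) : G u v = H u v := by
  obtain ⟨Q, hQ⟩ := isCompact_Icc.exists_bound_of_continuousOn hq
  have hdiff : ∀ u v, (u, v) ∈ goursatInterior a → DifferentiableAt ℝ (fun s => G u s - H u s) v :=
    fun u v h => (hG.differentiable_v u v h).sub (hH.differentiable_v u v h)
  have hmixed : ∀ u v, (u, v) ∈ goursatInterior a →
      HasDerivAt (fun r => deriv (fun s => G r s - H r s) v) (q (u + v) * (G u v - H u v)) u := by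
    intro u v h
    have hopen : IsOpen (goursatInterior a) :=
      (isOpen_lt continuous_const (continuous_fst.mul continuous_snd)).inter
        (isOpen_lt (continuous_fst.add continuous_snd).abs continuous_const)
    have hev : ∀ᶠ r in 𝓝 u, (r, v) ∈ goursatInterior a :=
      (by fun_prop : Continuous fun r : ℝ => (r, v)).continuousAt.eventually_mem
        (hopen.mem_nhds h)
    have := (hG.equation u v h).sub (hH.equation u v h)
    rw [← mul_sub] at this
    refine this.congr_of_eventuallyEq (hev.mono fun r hr => ?_)
    exact deriv_fun_sub (hG.differentiable_v r v hr) (hH.differentiable_v r v hr)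
  have hcont := hG.continuousOn.sub hH.continuousOn
  have hzu : ∀ u ∈ Icc (-a) a, G u 0 - H u 0 = 0 := fun u hu => by
    rw [hG.boundary_u u hu, hH.boundary_u u hu, sub_self]
  have hzv : ∀ v ∈ Icc (-a) a, G 0 v - H 0 v = 0 := fun v hv => by
    rw [hG.boundary_v v hv, hH.boundary_v v hv, sub_self]
  obtain ⟨h1, h2⟩ := huv
  dsimp only at h1 h2
  rw [abs_le] at h2
  rw [← sub_eq_zero]
  rcases mul_nonneg_iff.1 h1 with ⟨hu, hv⟩ | ⟨hu, hv⟩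
  · refine goursat_eq_zero_of_nonneg (D := fun u v => G u v - H u v) hQ (hcont.mono ?_) ?_ ?_ ?_ ?_
      hu hv h2.2
    · rintro ⟨x, y⟩ ⟨hx, hy, hxy⟩
      exact ⟨mul_nonneg hx hy, abs_le.2 ⟨by dsimp only at *; linarith, hxy⟩⟩
    · exact fun u v hu hv h => hdiff u v ⟨mul_pos hu hv, abs_lt.2 ⟨by dsimp only; linarith, h⟩⟩
    · exact fun u v hu hv h => hmixed u v ⟨mul_pos hu hv, abs_lt.2 ⟨by dsimp only; linarith, h⟩⟩
    · exact fun u hu h => hzu u ⟨by linarith, h⟩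
    · exact fun v hv h => hzv v ⟨by linarith, h⟩
  -- The third-quadrant triangle is reflected through the origin; the mixed derivative changes sign
  -- twice, so the equation persists with `q (-x)`.
  · have h := goursat_eq_zero_of_nonneg (D := fun u v => G (-u) (-v) - H (-u) (-v)) (a := a)
      (q := fun x => q (-x)) (Q := Q) (u := -u) (v := -v)
      (fun x hx => hQ (-x) ⟨by linarith [hx.2], by linarith [hx.1]⟩) ?_ ?_ ?_ ?_ ?_
      (by linarith) (by linarith) (by linarith)
    · simpa using h
    · refine hcont.comp (f := fun p : ℝ × ℝ => (-p.1, -p.2)) (by fun_prop) ?_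
      rintro ⟨x, y⟩ ⟨hx, hy, hxy⟩
      dsimp only at hx hy hxy
      refine ⟨?_, abs_le.2 ⟨?_, ?_⟩⟩ <;> dsimp only
      · rw [neg_mul_neg]; exact mul_nonneg hx hy
      · linarith
      · linarith
    · intro u v hu hv h
      have := hdiff (-u) (-v) ⟨by dsimp only; rw [neg_mul_neg]; exact mul_pos hu hv,
        abs_lt.2 ⟨by dsimp only; linarith, by dsimp only; linarith⟩⟩
      exact this.comp v differentiableAt_id.neg
    · intro u v hu hv h
      have := hmixed (-u) (-v) ⟨by dsimp only; rw [neg_mul_neg]; exact mul_pos hu hv,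
        abs_lt.2 ⟨by dsimp only; linarith, by dsimp only; linarith⟩⟩
      have h2 := (this.scomp u (hasDerivAt_neg u)).neg
      have heq : (fun r => deriv (fun s => G (-r) (-s) - H (-r) (-s)) v) =
          fun r => -deriv (fun s => G (-r) s - H (-r) s) (-v) := by
        ext r
        exact deriv_comp_neg (fun s => G (-r) s - H (-r) s) v
      rw [heq]
      refine h2.congr_deriv ?_
      rw [neg_smul, one_smul, neg_neg, neg_add]
    · intro u hu h
      simpa using hzu (-u) ⟨by linarith, by linarith⟩
    · intro v hv h
      simpa using hzv (-v) ⟨by linarith, by linarith⟩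

/-! ### Well-posedness for a potential on `[-a, a]`. -/

/-- Extending `q` by its end-point values keeps it bounded and continuous, so later derivatives can
be taken on all of `ℝ` without one-sided cases. -/
theorem exists_goursatIntegralSolution {a : ℝ} (ha : 0 ≤ a) {q : ℝ → ℂ}
    (hq : ContinuousOn q (Icc (-a) a)) :
    ∃ (q' : ℝ → ℂ) (H : ℝ → ℝ → ℂ), Continuous q' ∧ EqOn q' q (Icc (-a) a) ∧
      IsGoursatIntegralSolution q' H := by
  have haa : -a ≤ a := by linarith
  obtain ⟨Q, hQ⟩ := isCompact_Icc.exists_bound_of_continuousOn hq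
  have hc : Continuous (IccExtend haa ((Icc (-a) a).domRestrict q)) := hq.domRestrict.Icc_extend'
  obtain ⟨H, hH, hHe⟩ := exists_goursat_integral_solution hc (Q := Q)
    (fun x => hQ _ (projIcc (-a) a haa x).2)
  exact ⟨_, H, hc, fun x hx => IccExtend_of_mem haa _ hx, hH, hHe⟩

theorem goursatUniquelySolvable {a : ℝ} (ha : 0 ≤ a) {q : ℝ → ℂ}
    (hq : ContinuousOn q (Icc (-a) a)) : GoursatUniquelySolvable a q := by
  obtain ⟨q', H, hq', hqq, hH⟩ := exists_goursatIntegralSolution ha hq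
  exact ⟨H, hH.isGoursatSolution hq' ha hqq, fun G hG u v huv =>
    hG.unique hq (hH.isGoursatSolution hq' ha hqq) huv⟩

/-! ### Leibniz rules along antidiagonals. -/

theorem hasDerivAt_integral_param_of_continuous {F F' : ℝ → ℝ → ℂ}
    (hF : Continuous fun p : ℝ × ℝ => F p.1 p.2) (hF' : Continuous fun p : ℝ × ℝ => F' p.1 p.2)
    (hd : ∀ y v, HasDerivAt (fun r => F r v) (F' y v) y) (a b y : ℝ) :
    HasDerivAt (fun y => ∫ v in a..b, F y v) (∫ v in a..b, F' y v) y := by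
  obtain ⟨C, hC⟩ := ((isCompact_closedBall y 1).prod
    (isCompact_uIcc (a := a) (b := b))).exists_bound_of_continuousOn hF'.continuousOn
  have hFc : ∀ y, Continuous fun v => F y v := fun y =>
    hF.comp (by fun_prop : Continuous fun v => (y, v))
  have hFc' : ∀ y, Continuous fun v => F' y v := fun y =>
    hF'.comp (by fun_prop : Continuous fun v => (y, v))
  refine (intervalIntegral.hasDerivAt_integral_of_dominated_loc_of_deriv_le
    (bound := fun _ => C) (Metric.closedBall_mem_nhds y one_pos)
    (Eventually.of_forall fun y => (hFc y).aestronglyMeasurable)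
    ((hFc y).intervalIntegrable _ _) (hFc' y).aestronglyMeasurable
    (Eventually.of_forall fun t ht z hz => hC (z, t) ⟨hz, uIoc_subset_uIcc ht⟩)
    (continuous_const.intervalIntegrable _ _)
    (Eventually.of_forall fun t _ z _ => hd z t)).2

/-- Leibniz rule along the lines `u + v = x`, with the integrand differentiable in `u`. -/
theorem hasDerivAt_integral_antidiagonal_left {F F' : ℝ → ℝ → ℂ}
    (hF : Continuous fun p : ℝ × ℝ => F p.1 p.2) (hF' : Continuous fun p : ℝ × ℝ => F' p.1 p.2)
    (hd : ∀ u v, HasDerivAt (fun r => F r v) (F' u v) u) (x : ℝ) :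
    HasDerivAt (fun x => ∫ v in (0 : ℝ)..x, F (x - v) v)
      (F 0 x + ∫ v in (0 : ℝ)..x, F' (x - v) v) x := by
  have hG : Continuous fun p : ℝ × ℝ => F (p.1 - p.2) p.2 :=
    hF.comp (by fun_prop : Continuous fun p : ℝ × ℝ => (p.1 - p.2, p.2))
  have hG' : Continuous fun p : ℝ × ℝ => F' (p.1 - p.2) p.2 :=
    hF'.comp (by fun_prop : Continuous fun p : ℝ × ℝ => (p.1 - p.2, p.2))
  have hI' : Continuous fun p : ℝ × ℝ => ∫ v in (0 : ℝ)..p.2, F' (p.1 - v) v :=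
    intervalIntegral.continuous_parametric_intervalIntegral_of_continuous
      (f := fun (p : ℝ × ℝ) v => F' (p.1 - v) v)
      (hG'.comp ((continuous_fst.comp continuous_fst).prodMk continuous_snd)) continuous_snd
  have hspan : Continuous fun z : ℂ => ContinuousLinearMap.toSpanSingleton ℝ z :=
    (ContinuousLinearMap.toSpanSingletonCLE (𝕜 := ℝ) (E := ℂ)).continuous
  -- The line parameter `y` and the upper limit `t` are separated; continuous partial derivatives
  -- allow restriction to `y = t = x`.
  have h := hasStrictFDerivAt_uncurry_coprod (𝕜 := ℝ) (u := (x, x))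
    (f := fun y t => ∫ v in (0 : ℝ)..t, F (y - v) v)
    (f₁ := fun y t => ContinuousLinearMap.toSpanSingleton ℝ (∫ v in (0 : ℝ)..t, F' (y - v) v))
    (f₂ := fun y t => ContinuousLinearMap.toSpanSingleton ℝ (F (y - t) t))
    (Eventually.of_forall fun p => (hasDerivAt_integral_param_of_continuous hG hG'
      (fun y v => (hd (y - v) v).comp_sub_const y v) 0 p.2 p.1).hasFDerivAt)
    (Eventually.of_forall fun p => ((hG.comp (by fun_prop :
      Continuous fun v : ℝ => (p.1, v))).integral_hasStrictDerivAt 0 p.2).hasDerivAt.hasFDerivAt)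
    (hspan.comp hI').continuousAt (hspan.comp hG).continuousAt
  have h2 := h.hasFDerivAt.comp_hasDerivAt (f := fun x : ℝ => (x, x)) x
    ((hasDerivAt_id x).prodMk (hasDerivAt_id x))
  refine h2.congr_deriv ?_
  simp [Function.HasUncurry.uncurry, add_comm]

theorem integral_antidiagonal_swap (F : ℝ → ℝ → ℂ) (x : ℝ) :
    ∫ v in (0 : ℝ)..x, F (x - v) v = ∫ v in (0 : ℝ)..x, F v (x - v) := by
  have := intervalIntegral.integral_comp_sub_left (a := 0) (b := x) (fun v => F v (x - v)) x
  simpa using this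

/-- Leibniz rule along the lines `u + v = x`, with the integrand differentiable in `v`. -/
theorem hasDerivAt_integral_antidiagonal_right {F F' : ℝ → ℝ → ℂ}
    (hF : Continuous fun p : ℝ × ℝ => F p.1 p.2) (hF' : Continuous fun p : ℝ × ℝ => F' p.1 p.2)
    (hd : ∀ u v, HasDerivAt (fun s => F u s) (F' u v) v) (x : ℝ) :
    HasDerivAt (fun x => ∫ v in (0 : ℝ)..x, F (x - v) v)
      (F x 0 + ∫ v in (0 : ℝ)..x, F' (x - v) v) x := by
  simp only [integral_antidiagonal_swap]
  exact hasDerivAt_integral_antidiagonal_left (F := fun u v => F v u) (F' := fun u v => F' v u)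
    (hF.comp continuous_swap) (hF'.comp continuous_swap) (fun u v => hd v u) x

/-! ### The transmutation property for parameter zero. -/

/-- The transmutation operator with parameter `0` in characteristic coordinates. -/
noncomputable def charTransmutation (H : ℝ → ℝ → ℂ) (w : ℝ → ℂ) (x : ℝ) : ℂ :=
  w x + 2 * ∫ v in (0 : ℝ)..x, H (x - v) v * w (x - v - v)

/-- The derivative of `charTransmutation H w`, where `w'` is the derivative of `w`. -/
noncomputable def charTransmutationDeriv (q : ℝ → ℂ) (H : ℝ → ℝ → ℂ) (w w' : ℝ → ℂ) (x : ℝ) : ℂ :=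
  w' x + (∫ v in (0 : ℝ)..x, q (x - v) * w (x - v - v)) +
    2 * (∫ v in (0 : ℝ)..x, (∫ s in (0 : ℝ)..v, q (x - v + s) * H (x - v) s) * w (x - v - v)) +
    2 * ∫ v in (0 : ℝ)..x, H (x - v) v * w' (x - v - v)

theorem charTransmutation_zero (H : ℝ → ℝ → ℂ) (w : ℝ → ℂ) : charTransmutation H w 0 = w 0 := by
  simp [charTransmutation]

theorem charTransmutationDeriv_zero (q : ℝ → ℂ) (H : ℝ → ℝ → ℂ) (w w' : ℝ → ℂ) :
    charTransmutationDeriv q H w w' 0 = w' 0 := by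
  simp [charTransmutationDeriv]

section

variable {q : ℝ → ℂ} {H : ℝ → ℝ → ℂ} {w w' : ℝ → ℂ} {mu : ℂ}

theorem hasDerivAt_mul_comp_sub_left {A A' : ℝ → ℝ → ℂ} (hw : ∀ x, HasDerivAt w (w' x) x)
    (hA : ∀ u v, HasDerivAt (fun r => A r v) (A' u v) u) (u v : ℝ) :
    HasDerivAt (fun r => A r v * w (r - v)) (A' u v * w (u - v) + A u v * w' (u - v)) u :=
  (hA u v).mul ((hw (u - v)).comp_sub_const u v)

theorem hasDerivAt_mul_comp_sub_right {A A' : ℝ → ℝ → ℂ} (hw : ∀ x, HasDerivAt w (w' x) x)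
    (hA : ∀ u v, HasDerivAt (fun s => A u s) (A' u v) v) (u v : ℝ) :
    HasDerivAt (fun s => A u s * w (u - s)) (A' u v * w (u - v) - A u v * w' (u - v)) v := by
  have := (hA u v).mul ((hw (u - v)).comp_const_sub u v)
  rwa [mul_neg, ← sub_eq_add_neg] at this

theorem hasDerivAt_charTransmutation (hq : Continuous q) (hH : IsGoursatIntegralSolution q H)
    (hw : ∀ x, HasDerivAt w (w' x) x) (hw'c : Continuous w') (x : ℝ) :
    HasDerivAt (charTransmutation H w) (charTransmutationDeriv q H w w' x) x := by
  have hwc : Continuous w := continuous_iff_continuousAt.2 fun x => (hw x).continuousAt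
  have hHc := hH.continuous
  have hN := hH.continuous_integral_right hq
  have hN2 : Continuous fun v => ∫ s in (0 : ℝ)..v, q (x - v + s) * H (x - v) s :=
    hN.comp (by fun_prop : Continuous fun v => (x - v, v))
  have hH2 : Continuous fun v => H (x - v) v :=
    hHc.comp (by fun_prop : Continuous fun v => (x - v, v))
  have h := (hw x).add ((hasDerivAt_integral_antidiagonal_left
    (hHc.mul (hwc.comp (continuous_fst.sub continuous_snd))) (by fun_prop)
    (hasDerivAt_mul_comp_sub_left hw (hH.hasDerivAt_left hq)) x).const_mul (2 : ℂ))
  refine h.congr_deriv ?_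
  rw [charTransmutationDeriv, hH.zero_left, zero_mul, zero_add, add_assoc, add_assoc]
  congr 1
  rw [← intervalIntegral.integral_const_mul, ← intervalIntegral.integral_const_mul,
    ← intervalIntegral.integral_const_mul, ← intervalIntegral.integral_add,
    ← intervalIntegral.integral_add]
  · congr 1; ext v; ring
  all_goals exact Continuous.intervalIntegrable (by fun_prop) _ _

/-- Since `q` is only continuous, the terms containing `q (x - v)` cannot be differentiated in `u`.
On an antidiagonal integral the derivative may be taken in `v` instead, where `q u` is constant. The
boundary term `q x * w x` arises there. -/
theorem hasDerivAt_charTransmutationDeriv (hq : Continuous q)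
    (hH : IsGoursatIntegralSolution q H) (hw : ∀ x, HasDerivAt w (w' x) x)
    (hw' : ∀ x, HasDerivAt w' (mu * w x) x) (x : ℝ) :
    HasDerivAt (charTransmutationDeriv q H w w') ((q x + mu) * charTransmutation H w x) x := by
  have hwc : Continuous w := continuous_iff_continuousAt.2 fun x => (hw x).continuousAt
  have hw'c : Continuous w' := continuous_iff_continuousAt.2 fun x => (hw' x).continuousAt
  have hHc := hH.continuous
  have hN := hH.continuous_integral_right hq
  have hN2 : Continuous fun v => ∫ s in (0 : ℝ)..v, q (x - v + s) * H (x - v) s :=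
    hN.comp (by fun_prop : Continuous fun v => (x - v, v))
  have hH2 : Continuous fun v => H (x - v) v :=
    hHc.comp (by fun_prop : Continuous fun v => (x - v, v))
  have hNd : ∀ u v, HasDerivAt (fun v => ∫ s in (0 : ℝ)..v, q (u + s) * H u s)
      (q (u + v) * H u v) v := fun u v =>
    (((hH.continuous_source hq).comp (by fun_prop :
      Continuous fun s : ℝ => (u, s))).integral_hasStrictDerivAt 0 v).hasDerivAt
  have h1 := hasDerivAt_integral_antidiagonal_right (F := fun u v => q u * w (u - v))
    (by fun_prop) (by fun_prop)
    (hasDerivAt_mul_comp_sub_right (A := fun u _ => q u) (A' := fun _ _ => 0) hw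
      (fun u v => hasDerivAt_const v (q u))) x
  have h2 := hasDerivAt_integral_antidiagonal_right
    (F := fun u v => (∫ s in (0 : ℝ)..v, q (u + s) * H u s) * w (u - v))
    (by fun_prop) (by fun_prop) (hasDerivAt_mul_comp_sub_right hw hNd) x
  have h3 := hasDerivAt_integral_antidiagonal_left (F := fun u v => H u v * w' (u - v))
    (by fun_prop) (by fun_prop) (hasDerivAt_mul_comp_sub_left hw' (hH.hasDerivAt_left hq)) x
  have h := (((hw' x).add h1).add (h2.const_mul (2 : ℂ))).add (h3.const_mul (2 : ℂ))
  refine h.congr_deriv ?_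
  rw [charTransmutation, hH.zero_left, intervalIntegral.integral_same]
  -- All terms in `w'` cancel, and `q (x - v + v) = q x` leaves the integral.
  have key : (∫ v in (0 : ℝ)..x, (0 * w (x - v - v) - q (x - v) * w' (x - v - v))) +
      2 * (∫ v in (0 : ℝ)..x, (q (x - v + v) * H (x - v) v * w (x - v - v) -
        (∫ s in (0 : ℝ)..v, q (x - v + s) * H (x - v) s) * w' (x - v - v))) +
      2 * (∫ v in (0 : ℝ)..x, ((1 / 2 * q (x - v) +
        ∫ s in (0 : ℝ)..v, q (x - v + s) * H (x - v) s) * w' (x - v - v) +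
          H (x - v) v * (mu * w (x - v - v)))) =
      2 * (q x + mu) * ∫ v in (0 : ℝ)..x, H (x - v) v * w (x - v - v) := by
    simp only [sub_add_cancel]
    rw [← intervalIntegral.integral_const_mul, ← intervalIntegral.integral_const_mul,
      ← intervalIntegral.integral_const_mul, ← intervalIntegral.integral_add,
      ← intervalIntegral.integral_add]
    · congr 1; ext v; ring
    all_goals exact Continuous.intervalIntegrable (by fun_prop) _ _
  rw [sub_zero]
  linear_combination key

end

/-! ### Reduction of a general parameter to zero. -/

theorem integral_kernel_mul (H : ℝ → ℝ → ℂ) (w : ℝ → ℂ) (x : ℝ) :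
    ∫ t in (-x)..x, kernel H x t * w t = 2 * ∫ v in (0 : ℝ)..x, H (x - v) v * w (x - v - v) := by
  have h := intervalIntegral.integral_comp_sub_mul (a := 0) (b := x)
    (fun t => kernel H x t * w t) (two_ne_zero' ℝ) x
  have h2 : ∀ v, kernel H x (x - 2 * v) * w (x - 2 * v) = H (x - v) v * w (x - v - v) := by
    intro v
    rw [kernel]
    ring_nf
  simp only [h2, mul_zero, sub_zero, (by ring : x - 2 * x = -x)] at h
  rw [h, Complex.real_smul]
  push_cast
  ring

theorem transmutation_eq_charTransmutation {H : ℝ → ℝ → ℂ} {w : ℝ → ℂ}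
    (hH : Continuous fun p : ℝ × ℝ => H p.1 p.2) (hw : Continuous w) (kappa : ℂ) (x : ℝ) :
    transmutation H kappa w x =
      charTransmutation H (fun s => w s + kappa / 2 * ∫ t in (-s)..s, w t) x := by
  have hK : Continuous (kernel H x) :=
    hH.comp (by fun_prop : Continuous fun t : ℝ => ((x + t) / 2, (x - t) / 2))
  have hneg : ∀ φ : ℝ → ℂ, ∫ s in (-x)..x, φ (-s) = ∫ s in (-x)..x, φ s := fun φ => by
    simp
  set k : ℝ → ℂ := fun s => kernel H x s - kernel H x (-s) with hk
  have hkc : Continuous k := by fun_prop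
  set V : ℝ → ℂ := fun s => ∫ t in (0 : ℝ)..s, w t with hV
  have hVd : ∀ s, HasDerivAt V (w s) s := fun s => (hw.integral_hasStrictDerivAt 0 s).hasDerivAt
  have hVc : Continuous V := continuous_iff_continuousAt.2 fun s => (hVd s).continuousAt
  have hVsub : ∀ s, V s - V (-s) = ∫ t in (-s)..s, w t := fun s =>
    intervalIntegral.integral_interval_sub_left (hw.intervalIntegrable _ _)
      (hw.intervalIntegrable _ _)
  set A : ℝ → ℂ := fun t => ∫ s in t..x, k s with hA
  have hAd : ∀ t, HasDerivAt A (-k t) t := fun t =>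
    intervalIntegral.integral_hasDerivAt_left (hkc.intervalIntegrable _ _)
      (hkc.stronglyMeasurableAtFilter _ _) hkc.continuousAt
  have hAc : Continuous A := continuous_iff_continuousAt.2 fun s => (hAd s).continuousAt
  have hAx : A x = 0 := intervalIntegral.integral_same
  -- The integrand is odd, so both boundary terms in the integration by parts vanish.
  have hAnx : A (-x) = 0 := by
    change ∫ s in (-x)..x, (kernel H x s - kernel H x (-s)) = 0
    rw [intervalIntegral.integral_sub (hK.intervalIntegrable _ _)
      (Continuous.intervalIntegrable (by fun_prop) _ _), hneg, sub_self]
  have hparts : ∫ t in (-x)..x, A t * w t =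
      ∫ t in (-x)..x, kernel H x t * ∫ r in (-t)..t, w r := by
    rw [intervalIntegral.integral_mul_deriv_eq_deriv_mul (fun t _ => hAd t) (fun t _ => hVd t)
      (hkc.neg.intervalIntegrable _ _) (hw.intervalIntegrable _ _), hAx, hAnx]
    have h1 : ∫ t in (-x)..x, -k t * V t = (∫ t in (-x)..x, kernel H x (-t) * V t) -
        ∫ t in (-x)..x, kernel H x t * V t := by
      rw [← intervalIntegral.integral_sub]
      · congr 1; ext t; simp only [hk]; ring
      all_goals exact Continuous.intervalIntegrable (by fun_prop) _ _
    have h2 := hneg (fun t => kernel H x t * V (-t))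
    simp only [neg_neg] at h2
    rw [h1, h2, zero_mul, zero_mul, sub_zero, zero_sub, neg_sub, ← intervalIntegral.integral_sub]
    · congr 1; ext t; rw [← hVsub]; ring
    all_goals exact Continuous.intervalIntegrable (by fun_prop) _ _
  have hE : Continuous fun s => ∫ t in (-s)..s, w t := by
    simp only [← hVsub]; fun_prop
  have hsplit : ∫ t in (-x)..x, paramKernel H kappa x t * w t =
      kappa / 2 * (∫ t in (-x)..x, w t) + (∫ t in (-x)..x, kernel H x t * w t) +
        kappa / 2 * ∫ t in (-x)..x, A t * w t := by
    rw [← intervalIntegral.integral_const_mul, ← intervalIntegral.integral_const_mul,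
      ← intervalIntegral.integral_add, ← intervalIntegral.integral_add]
    · congr 1; ext t; simp only [paramKernel, hA, hk]; ring
    all_goals exact Continuous.intervalIntegrable (by fun_prop) _ _
  have hcomb : (∫ t in (-x)..x, kernel H x t * w t) +
      kappa / 2 * (∫ t in (-x)..x, kernel H x t * ∫ r in (-t)..t, w r) =
      ∫ t in (-x)..x, kernel H x t * (w t + kappa / 2 * ∫ r in (-t)..t, w r) := by
    rw [← intervalIntegral.integral_const_mul, ← intervalIntegral.integral_add]
    · congr 1; ext t; ring
    all_goals exact Continuous.intervalIntegrable (by fun_prop) _ _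
  rw [transmutation, charTransmutation,
    ← integral_kernel_mul H (fun s => w s + kappa / 2 * ∫ t in (-s)..s, w t), hsplit, hparts,
    ← hcomb]
  ring

/-- The transmutation property: `T_κ` maps solutions of `w'' = μ w` to solutions of
`y'' = (q + μ) y`. -/
theorem exists_hasDerivAt_transmutation {q : ℝ → ℂ} {H : ℝ → ℝ → ℂ} {w w' : ℝ → ℂ} {mu : ℂ}
    (hq : Continuous q) (hH : IsGoursatIntegralSolution q H) (hw : ∀ x, HasDerivAt w (w' x) x)
    (hw' : ∀ x, HasDerivAt w' (mu * w x) x) (kappa : ℂ) :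
    transmutation H kappa w 0 = w 0 ∧ ∃ y' : ℝ → ℂ, y' 0 = w' 0 + kappa * w 0 ∧
      (∀ x, HasDerivAt (transmutation H kappa w) (y' x) x) ∧
      ∀ x, HasDerivAt y' ((q x + mu) * transmutation H kappa w x) x := by
  have hwc : Continuous w := continuous_iff_continuousAt.2 fun x => (hw x).continuousAt
  have hw'c : Continuous w' := continuous_iff_continuousAt.2 fun x => (hw' x).continuousAt
  have hT : transmutation H kappa w =
      charTransmutation H (fun s => w s + kappa / 2 * ∫ t in (-s)..s, w t) :=
    funext (transmutation_eq_charTransmutation hH.continuous hwc kappa)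
  have hE : ∀ s, ∫ t in (-s)..s, w t = (∫ t in (0 : ℝ)..s, w t) - ∫ t in (0 : ℝ)..(-s), w t :=
    fun s => (intervalIntegral.integral_interval_sub_left (hwc.intervalIntegrable _ _)
      (hwc.intervalIntegrable _ _)).symm
  have hEd : ∀ s, HasDerivAt (fun s => ∫ t in (-s)..s, w t) (w s + w (-s)) s := by
    intro s
    simp only [hE]
    have h := (hwc.integral_hasStrictDerivAt 0 s).hasDerivAt.sub
      ((hwc.integral_hasStrictDerivAt 0 (-s)).hasDerivAt.scomp s (hasDerivAt_neg s))
    refine h.congr_deriv ?_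
    rw [neg_smul, one_smul, sub_neg_eq_add]
  have hE2 : ∀ s, mu * (∫ t in (-s)..s, w t) = w' s - w' (-s) := by
    intro s
    rw [← intervalIntegral.integral_const_mul]
    exact intervalIntegral.integral_eq_sub_of_hasDerivAt (fun t _ => hw' t)
      (Continuous.intervalIntegrable (by fun_prop) _ _)
  have hW : ∀ s, HasDerivAt (fun s => w s + kappa / 2 * ∫ t in (-s)..s, w t)
      (w' s + kappa / 2 * (w s + w (-s))) s := fun s => (hw s).add ((hEd s).const_mul _)
  have hW' : ∀ s, HasDerivAt (fun s => w' s + kappa / 2 * (w s + w (-s)))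
      (mu * (w s + kappa / 2 * ∫ t in (-s)..s, w t)) s := by
    intro s
    have h := (hw' s).add (((hw s).add ((hw (-s)).scomp s (hasDerivAt_neg s))).const_mul
      (kappa / 2))
    refine h.congr_deriv ?_
    rw [neg_smul, one_smul]
    linear_combination -kappa / 2 * hE2 s
  rw [hT]
  refine ⟨by simp [charTransmutation_zero], _, ?_,
    fun x => hasDerivAt_charTransmutation hq hH hW (by fun_prop) x,
    fun x => hasDerivAt_charTransmutationDeriv hq hH hW hW' x⟩
  rw [charTransmutationDeriv_zero, neg_zero]
  ring

/-! ### Uniqueness for linear systems and global extension of `u`. -/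

theorem linear_system_eq_zero {a C : ℝ} (ha : 0 < a) {α β γ δ y p : ℝ → ℂ}
    (hα : ∀ t ∈ Ioo (-a) a, ‖α t‖ ≤ C) (hβ : ∀ t ∈ Ioo (-a) a, ‖β t‖ ≤ C)
    (hγ : ∀ t ∈ Ioo (-a) a, ‖γ t‖ ≤ C) (hδ : ∀ t ∈ Ioo (-a) a, ‖δ t‖ ≤ C)
    (hy : ∀ t ∈ Ioo (-a) a, HasDerivAt y (α t * y t + β t * p t) t)
    (hp : ∀ t ∈ Ioo (-a) a, HasDerivAt p (γ t * y t + δ t * p t) t)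
    (hy0 : y 0 = 0) (hp0 : p 0 = 0) {t : ℝ} (ht : t ∈ Ioo (-a) a) : y t = 0 ∧ p t = 0 := by
  have h0 : (0 : ℝ) ∈ Ioo (-a) a := ⟨by linarith, ha⟩
  have hC : 0 ≤ C := (norm_nonneg _).trans (hα 0 h0)
  have aux : ∀ c d : ℂ, ‖c‖ ≤ C → ‖d‖ ≤ C → ∀ z z' : ℂ × ℂ,
      ‖c * z.1 + d * z.2 - (c * z'.1 + d * z'.2)‖ ≤ 2 * C * ‖z - z'‖ := by
    intro c d hc hd z z'
    have h1 : c * z.1 + d * z.2 - (c * z'.1 + d * z'.2) =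
        c * (z - z').1 + d * (z - z').2 := by
      simp only [Prod.fst_sub, Prod.snd_sub]; ring
    rw [h1]
    calc _ ≤ ‖c‖ * ‖(z - z').1‖ + ‖d‖ * ‖(z - z').2‖ :=
          (norm_add_le _ _).trans (by rw [norm_mul, norm_mul])
      _ ≤ C * ‖z - z'‖ + C * ‖z - z'‖ := by
          gcongr
          · exact norm_fst_le _
          · exact norm_snd_le _
      _ = _ := by ring
  have h := ODE_solution_unique_of_mem_Ioo (K := ⟨2 * C, by positivity⟩) (s := fun _ => univ)
    (v := fun t (z : ℂ × ℂ) => (α t * z.1 + β t * z.2, γ t * z.1 + δ t * z.2))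
    (f := fun t => (y t, p t)) (g := fun _ => 0) (a := -a) (b := a) (t₀ := 0) ?_ h0
    (fun t ht => ⟨(hy t ht).prodMk (hp t ht), mem_univ _⟩) ?_ (by simp [hy0, hp0]) ht
  · simpa using h
  · intro t ht
    refine LipschitzOnWith.of_dist_le_mul fun z _ z' _ => ?_
    rw [dist_eq_norm, dist_eq_norm, Prod.norm_def]
    exact max_le (aux _ _ (hα t ht) (hβ t ht) z z') (aux _ _ (hγ t ht) (hδ t ht) z z')
  · intro t _
    refine ⟨?_, mem_univ _⟩
    refine (hasDerivAt_const t (0 : ℂ × ℂ)).congr_deriv ?_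
    simp only [Prod.fst_zero, Prod.snd_zero, mul_zero, add_zero]
    rfl

theorem exists_harmonic_solution (ω c d : ℂ) : ∃ w w' : ℝ → ℂ, w 0 = c ∧ w' 0 = d ∧
    (∀ x, HasDerivAt w (w' x) x) ∧ ∀ x, HasDerivAt w' (-ω ^ 2 * w x) x := by
  have hlin : ∀ (k : ℂ) (x : ℝ), HasDerivAt (fun x : ℝ => k * (x : ℂ)) k x := fun k x => by
    simpa using (Complex.ofRealCLM.hasDerivAt (x := x)).const_mul k
  rcases eq_or_ne ω 0 with rfl | hω
  · refine ⟨fun x => c + d * x, fun _ => d, by simp, rfl, fun x => ?_, fun x => ?_⟩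
    · exact (hlin d x).const_add c
    · simpa using hasDerivAt_const x d
  · have hcos : ∀ x : ℝ, HasDerivAt (fun x : ℝ => Complex.cos (ω * x))
        (-Complex.sin (ω * x) * ω) x := fun x => (Complex.hasDerivAt_cos _).comp x (hlin ω x)
    have hsin : ∀ x : ℝ, HasDerivAt (fun x : ℝ => Complex.sin (ω * x))
        (Complex.cos (ω * x) * ω) x := fun x => (Complex.hasDerivAt_sin _).comp x (hlin ω x)
    refine ⟨fun x => c * Complex.cos (ω * x) + d / ω * Complex.sin (ω * x),
      fun x => -(c * ω) * Complex.sin (ω * x) + d * Complex.cos (ω * x), by simp, by simp,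
      fun x => ?_, fun x => ?_⟩
    · refine (((hcos x).const_mul c).add ((hsin x).const_mul (d / ω))).congr_deriv ?_
      field_simp
    · refine (((hsin x).const_mul (-(c * ω))).add ((hcos x).const_mul d)).congr_deriv ?_
      field_simp
      ring

namespace IsSLSolution

variable {a : ℝ} {q u : ℝ → ℂ} {lam : ℂ}

theorem hasDerivAt (hu : IsSLSolution a q lam u) {x : ℝ} (hx : x ∈ Ioo (-a) a) :
    HasDerivAt u (deriv u x) x :=
  ((hu.contDiffOn_Ioo.differentiableOn two_ne_zero).differentiableAt
    (isOpen_Ioo.mem_nhds hx)).hasDerivAt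

theorem hasDerivAt_deriv (hu : IsSLSolution a q lam u) {x : ℝ} (hx : x ∈ Ioo (-a) a) :
    HasDerivAt (deriv u) ((q x + lam) * u x) x := by
  have h1 : ContDiffOn ℝ 1 (deriv u) (Ioo (-a) a) :=
    hu.contDiffOn_Ioo.deriv_of_isOpen isOpen_Ioo (by norm_num)
  have h2 := ((h1.differentiableOn one_ne_zero).differentiableAt
    (isOpen_Ioo.mem_nhds hx)).hasDerivAt
  refine h2.congr_deriv ?_
  linear_combination hu.equation x hx

theorem continuousOn_derivWithin (hu : IsSLSolution a q lam u) (ha : 0 < a) :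
    ContinuousOn (derivWithin u (Icc (-a) a)) (Icc (-a) a) :=
  hu.contDiffOn_Icc.continuousOn_derivWithin (uniqueDiffOn_Icc (by linarith)) le_rfl

/-- The transmutation lemmas need derivatives on all of `ℝ`; the explicit solution with the data of
`u` at `0` supplies them and matches `u` up to the end points. -/
theorem exists_global {ω : ℂ} (ha : 0 < a) (hu : IsSLSolution a (fun _ => 0) (-ω ^ 2) u) :
    ∃ w w' : ℝ → ℂ, EqOn u w (Icc (-a) a) ∧ EqOn (derivWithin u (Icc (-a) a)) w' (Icc (-a) a) ∧
      (∀ x, HasDerivAt w (w' x) x) ∧ ∀ x, HasDerivAt w' (-ω ^ 2 * w x) x := by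
  obtain ⟨w, w', hw0, hw'0, hw, hw'⟩ := exists_harmonic_solution ω (u 0) (deriv u 0)
  have hwc : Continuous w := continuous_iff_continuousAt.2 fun x => (hw x).continuousAt
  have hIoo : EqOn u w (Ioo (-a) a) := by
    intro t ht
    have h := linear_system_eq_zero (C := 1 + ‖-ω ^ 2‖) ha (α := fun _ => 0) (β := fun _ => 1)
      (γ := fun _ => -ω ^ 2) (δ := fun _ => 0) (y := fun t => u t - w t)
      (p := fun t => deriv u t - w' t)
      (fun t _ => by rw [norm_zero]; positivity)
      (fun t _ => by rw [norm_one]; linarith [norm_nonneg (-ω ^ 2)])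
      (fun t _ => by linarith) (fun t _ => by rw [norm_zero]; positivity)
      (fun t ht => ((hu.hasDerivAt ht).sub (hw t)).congr_deriv (by ring))
      (fun t ht => ((hu.hasDerivAt_deriv ht).sub (hw' t)).congr_deriv (by ring))
      (by rw [hw0, sub_self]) (by rw [hw'0, sub_self]) ht
    exact sub_eq_zero.1 h.1
  have hIcc : EqOn u w (Icc (-a) a) :=
    hIoo.of_subset_closure hu.contDiffOn_Icc.continuousOn hwc.continuousOn Ioo_subset_Icc_self
      (closure_Ioo (by linarith : -a ≠ a)).ge
  refine ⟨w, w', hIcc, fun x hx => ?_, hw, hw'⟩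
  rw [derivWithin_congr hIcc (hIcc hx)]
  exact (hw x).hasDerivWithinAt.derivWithin (uniqueDiffOn_Icc (by linarith) x hx)

end IsSLSolution

/-! ### The Darboux transformation of solutions. -/

theorem transmutation_congr {a : ℝ} {G H : ℝ → ℝ → ℂ} {u w : ℝ → ℂ}
    (hGH : ∀ r s, (r, s) ∈ goursatDomain a → G r s = H r s) (huw : EqOn u w (Icc (-a) a))
    (kappa : ℂ) {x : ℝ} (hx : x ∈ Icc (-a) a) :
    transmutation G kappa u x = transmutation H kappa w x := by
  have hxa : |x| ≤ a := abs_le.2 hx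
  have habs : ∀ t ∈ uIcc (-x) x, |t| ≤ |x| := by
    intro t ht
    rcases le_total 0 x with h | h
    · rw [uIcc_of_le (by linarith)] at ht
      rw [abs_of_nonneg h]; exact abs_le.2 ht
    · rw [uIcc_of_ge (by linarith)] at ht
      rw [abs_of_nonpos h]; exact abs_le.2 ⟨by linarith [ht.1], ht.2⟩
  have hker : ∀ t, |t| ≤ |x| → kernel G x t = kernel H x t := by
    intro t ht
    refine hGH _ _ ⟨?_, ?_⟩
    · have := sq_le_sq.2 ht
      dsimp only
      nlinarith
    · dsimp only
      rwa [(by ring : (x + t) / 2 + (x - t) / 2 = x)]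
  rw [transmutation, transmutation, huw hx]
  congr 1
  refine intervalIntegral.integral_congr fun t ht => ?_
  have ht' := habs t ht
  have hinner : ∫ s in t..x, (kernel G x s - kernel G x (-s)) =
      ∫ s in t..x, (kernel H x s - kernel H x (-s)) := by
    refine intervalIntegral.integral_congr fun s hs => ?_
    have hs' := habs s (uIcc_subset_uIcc ht right_mem_uIcc hs)
    rw [hker s hs', hker (-s) (by rwa [abs_neg])]
  rw [paramKernel, paramKernel, hinner, hker t ht', huw (abs_le.1 (ht'.trans hxa))]

theorem continuousOn_darbouxPotential {a : ℝ} (ha : 0 < a) {q f : ℝ → ℂ} {lam : ℂ}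
    (hq : ContinuousOn q (Icc (-a) a)) (hf : IsSLSolution a q lam f)
    (hf_ne : ∀ x ∈ Icc (-a) a, f x ≠ 0) :
    ContinuousOn (darbouxPotential a q f) (Icc (-a) a) :=
  (continuousOn_const.mul (((hf.continuousOn_derivWithin ha).div
    hf.contDiffOn_Icc.continuousOn hf_ne).pow 2)).sub hq

/-- The Darboux transformation of a solution `y₁` of `y'' = (q + μ) y` agrees with the solution
`y₂` of the equation with the transformed potential that has the matching initial values. -/
theorem darboux_eq_of_hasDerivAt {a : ℝ} (ha : 0 < a) {q f : ℝ → ℂ} {mu : ℂ}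
    (hf : IsSLSolution a q 0 f) (hf_ne : ∀ x ∈ Icc (-a) a, f x ≠ 0) (hf_zero : f 0 = 1)
    {y₁ y₁' y₂ y₂' : ℝ → ℂ} (hy₁ : ∀ x, HasDerivAt y₁ (y₁' x) x)
    (hy₁' : ∀ x ∈ Ioo (-a) a, HasDerivAt y₁' ((q x + mu) * y₁ x) x)
    (hy₂ : ∀ x, HasDerivAt y₂ (y₂' x) x)
    (hy₂' : ∀ x ∈ Ioo (-a) a, HasDerivAt y₂' ((darbouxPotential a q f x + mu) * y₂ x) x)
    (h1 : y₁ 0 = y₂' 0 + deriv f 0 * y₂ 0) (h1' : y₁' 0 = mu * y₂ 0 + deriv f 0 * y₁ 0)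
    {x : ℝ} (hx : x ∈ Icc (-a) a) :
    1 / f x * ((∫ η in (0 : ℝ)..x, f η * y₁ η) + y₂ 0) = y₂ x := by
  have haa : -a ≤ a := by linarith
  have h0 : (0 : ℝ) ∈ Icc (-a) a := ⟨by linarith, ha.le⟩
  have hy₁c : Continuous y₁ := continuous_iff_continuousAt.2 fun x => (hy₁ x).continuousAt
  have hy₂c : Continuous y₂ := continuous_iff_continuousAt.2 fun x => (hy₂ x).continuousAt
  have hfc := hf.contDiffOn_Icc.continuousOn
  set F : ℝ → ℂ := IccExtend haa ((Icc (-a) a).domRestrict f) with hF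
  have hFc : Continuous F := hfc.domRestrict.Icc_extend'
  have hFf : EqOn F f (Icc (-a) a) := fun x hx => IccExtend_of_mem haa _ hx
  set I : ℝ → ℂ := fun x => (∫ η in (0 : ℝ)..x, F η * y₁ η) + y₂ 0 with hI
  have hId : ∀ x, HasDerivAt I (F x * y₁ x) x := fun x =>
    ((hFc.mul hy₁c).integral_hasStrictDerivAt 0 x).hasDerivAt.add_const _
  have hI0 : I 0 = y₂ 0 := by simp [hI]
  have hIc : Continuous I := continuous_iff_continuousAt.2 fun x => (hId x).continuousAt
  have hIf : ∀ x ∈ Icc (-a) a, (∫ η in (0 : ℝ)..x, f η * y₁ η) + y₂ 0 = I x := by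
    intro x hx
    simp only [hI]
    congr 1
    refine intervalIntegral.integral_congr fun s hs => ?_
    rw [hFf (uIcc_subset_Icc h0 hx hs)]
  have hsub : Ioo (-a) a ⊆ Icc (-a) a := Ioo_subset_Icc_self
  -- The Wronskian of `f` and `y₁` has derivative `mu * f * y₁`, which is also that of `mu * I`.
  -- Their difference is constant (the system with zero coefficients) and vanishes at `0` by `h1'`.
  have hW : ∀ t ∈ Ioo (-a) a, f t * y₁' t - deriv f t * y₁ t - mu * I t = 0 := by
    intro t ht
    refine (linear_system_eq_zero (C := 0) ha (α := 0) (β := 0) (γ := 0) (δ := 0)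
      (y := fun t => f t * y₁' t - deriv f t * y₁ t - mu * I t) (p := fun _ => 0)
      (by simp) (by simp) (by simp) (by simp) (fun t ht => ?_) (fun t _ => ?_) ?_ rfl ht).1
    · refine ((((hf.hasDerivAt ht).mul (hy₁' t ht)).sub
        ((hf.hasDerivAt_deriv ht).mul (hy₁ t))).sub ((hId t).const_mul mu)).congr_deriv ?_
      rw [hFf (hsub ht)]
      simp only [Pi.zero_apply]
      ring
    · simpa using hasDerivAt_const t (0 : ℂ)
    · simp only [hI0, hf_zero, h1']
      ring
  obtain ⟨C, hC⟩ := isCompact_Icc.exists_bound_of_continuousOn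
    ((hf.continuousOn_derivWithin ha).div hfc hf_ne)
  -- Riccati equation `g' = q - g²` for `g = f'/f`; with the transformed potential `2 g² - q`, it
  -- cancels the `g²` terms in the derivative of `y₂' + g y₂`.
  have hgd : ∀ t ∈ Ioo (-a) a, HasDerivAt (fun t => deriv f t / f t)
      (q t - (deriv f t / f t) ^ 2) t := by
    intro t ht
    have hne := hf_ne t (hsub ht)
    refine ((hf.hasDerivAt_deriv ht).div (hf.hasDerivAt ht) hne).congr_deriv ?_
    field_simp
    ring
  have hgC : ∀ t ∈ Ioo (-a) a, ‖deriv f t / f t‖ ≤ 1 + C + ‖mu‖ := by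
    intro t ht
    have h := hC t (hsub ht)
    rw [Pi.div_apply, derivWithin_of_mem_nhds (Icc_mem_nhds ht.1 ht.2)] at h
    linarith [norm_nonneg mu]
  have hC0 : 0 ≤ C := (norm_nonneg _).trans (hC 0 h0)
  have hIoo : EqOn (fun x => I x / f x) y₂ (Ioo (-a) a) := by
    intro t ht
    refine sub_eq_zero.1 (linear_system_eq_zero (C := 1 + C + ‖mu‖) ha
      (α := fun t => -(deriv f t / f t)) (β := fun _ => 1) (γ := fun _ => mu)
      (δ := fun t => deriv f t / f t) (y := fun t => I t / f t - y₂ t)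
      (p := fun t => y₁ t - (y₂' t + deriv f t / f t * y₂ t))
      (fun t ht => by rw [norm_neg]; exact hgC t ht)
      (fun t ht => by rw [norm_one]; linarith [norm_nonneg mu]) (fun t ht => by linarith)
      hgC (fun t ht => ?_) (fun t ht => ?_) ?_ ?_ ht).1
    · have hne := hf_ne t (hsub ht)
      refine (((hId t).div (hf.hasDerivAt ht) hne).sub (hy₂ t)).congr_deriv ?_
      rw [hFf (hsub ht)]
      field_simp
      ring
    · have hne := hf_ne t (hsub ht)
      refine ((hy₁ t).sub ((hy₂' t ht).add ((hgd t ht).mul (hy₂ t)))).congr_deriv ?_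
      have hWt := hW t ht
      rw [darbouxPotential, derivWithin_of_mem_nhds (Icc_mem_nhds ht.1 ht.2)]
      have hy : y₁' t = deriv f t / f t * y₁ t + mu * (I t / f t) := by
        field_simp
        linear_combination hWt
      rw [hy]
      ring
    · simp only [hI0, hf_zero, div_one, sub_self]
    · simp only [hf_zero, div_one, h1, sub_self]
  rw [hIf x hx, one_div, inv_mul_eq_div]
  exact hIoo.of_subset_closure (hIc.continuousOn.div hfc hf_ne) hy₂c.continuousOn hsub
    (closure_Ioo (by linarith : -a ≠ a)).ge hx

end DarbouxTransmutation

/-! ### Assembly of the theorem. -/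

theorem mainTheorem5 (a : ℝ) (ha : 0 < a) (q₁ f : ℝ → ℂ)
    (hq₁ : ContinuousOn q₁ (Set.Icc (-a) a))
    (hf : DarbouxTransmutation.IsSLSolution a q₁ 0 f)
    (hf_ne : ∀ x ∈ Set.Icc (-a) a, f x ≠ 0)
    (hf_zero : f 0 = 1) :
    DarbouxTransmutation.GoursatUniquelySolvable a q₁ ∧
    DarbouxTransmutation.GoursatUniquelySolvable a
      (DarbouxTransmutation.darbouxPotential a q₁ f) ∧
    ∀ H₁ H₂ : ℝ → ℝ → ℂ,
      DarbouxTransmutation.IsGoursatSolution a q₁ H₁ →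
      DarbouxTransmutation.IsGoursatSolution a
        (DarbouxTransmutation.darbouxPotential a q₁ f) H₂ →
      ∀ (ω : ℂ) (u : ℝ → ℂ),
        DarbouxTransmutation.IsSLSolution a (fun _ => 0) (-ω ^ 2) u →
        ∀ x ∈ Set.Icc (-a) a,
          DarbouxTransmutation.darbouxOperator a f
              (DarbouxTransmutation.transmutation H₁ (deriv f 0)) u x =
            DarbouxTransmutation.transmutation H₂ (-deriv f 0) u x := by
  open DarbouxTransmutation in
  have hq₂ := continuousOn_darbouxPotential ha hq₁ hf hf_ne
  refine ⟨goursatUniquelySolvable ha.le hq₁, goursatUniquelySolvable ha.le hq₂, ?_⟩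
  intro H₁ H₂ hH₁ hH₂ ω u hu x hx
  obtain ⟨r₁, G₁, hr₁, hrq₁, hG₁⟩ := exists_goursatIntegralSolution ha.le hq₁
  obtain ⟨r₂, G₂, hr₂, hrq₂, hG₂⟩ := exists_goursatIntegralSolution ha.le hq₂
  obtain ⟨w, w', huw, huw', hw, hw'⟩ := hu.exists_global ha
  -- The pair `(w', -ω ^ 2 * w)` solves the same harmonic system, so the transmutation property
  -- applies to `w'` as well.
  obtain ⟨hy₁0, y₁', hy₁'0, hy₁, hy₁'⟩ := exists_hasDerivAt_transmutation hr₁ hG₁ hw'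
    (fun x => (hw x).const_mul (-ω ^ 2)) (deriv f 0)
  obtain ⟨hy₂0, y₂', hy₂'0, hy₂, hy₂'⟩ := exists_hasDerivAt_transmutation hr₂ hG₂ hw hw'
    (-deriv f 0)
  have h0 : (0 : ℝ) ∈ Set.Icc (-a) a := ⟨by linarith, ha.le⟩
  have hHG₁ : ∀ r s, (r, s) ∈ goursatDomain a → H₁ r s = G₁ r s := fun r s h =>
    hH₁.unique hq₁ (hG₁.isGoursatSolution hr₁ ha.le hrq₁) h
  have hHG₂ : ∀ r s, (r, s) ∈ goursatDomain a → H₂ r s = G₂ r s := fun r s h =>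
    hH₂.unique hq₂ (hG₂.isGoursatSolution hr₂ ha.le hrq₂) h
  have hint : ∫ η in (0 : ℝ)..x,
      f η * transmutation H₁ (deriv f 0) (derivWithin u (Set.Icc (-a) a)) η =
      ∫ η in (0 : ℝ)..x, f η * transmutation G₁ (deriv f 0) w' η := by
    refine intervalIntegral.integral_congr fun s hs => ?_
    rw [transmutation_congr hHG₁ huw' _ (Set.uIcc_subset_Icc h0 hx hs)]
  rw [darbouxOperator, hint, transmutation_congr hHG₂ huw _ hx, huw h0, ← hy₂0]
  refine darboux_eq_of_hasDerivAt ha hf hf_ne hf_zero (mu := -ω ^ 2) hy₁ (fun t ht => ?_) hy₂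
    (fun t ht => ?_) ?_ ?_ hx
  · rw [← hrq₁ (Set.Ioo_subset_Icc_self ht)]
    exact hy₁' t
  · rw [← hrq₂ (Set.Ioo_subset_Icc_self ht)]
    exact hy₂' t
  · rw [hy₁0, hy₂0, hy₂'0]; ring
  · rw [hy₁'0, hy₁0, hy₂0]
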